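/- All graphs are finite and simple. A snark is a bridgeless cubic graph that has no proper $3$-edge-coloring (nothing is required about connectivity or girth). For a proper edge-coloring $\sigma$ and a vertex $v$ let $\sigma(v)$ be the set of the colors of the edges at $v$. An edge $uv$ is poor if $|\sigma(u)\cup\sigma(v)|=3$ and rich if $|\sigma(u)\cup\sigma(v)|=5$; a normal $5$-edge-coloring is a proper edge-coloring with $5$ colors in which every edge is poor or rich. Let $B=(P_{10})_{u_1,u_2}$ be the Petersen superedge, obtained from the Petersen graph $P_{10}$ by removing two non-adjacent vertices $u_1,u_2$ and keeping the edges at them as semiedges. It has the vertices $a,b,c,d,e,f,g,h$ and the nine edges $ab,be,bf,cd,gh,cf,de,eg,fh$; its first connector (from $u_1$) has one semiedge at each of $a,c,g$, and its second connector (from $u_2$) has one semiedge at each of $a,d,h$. Let $G$ be a snark and $C=w_0w_1\cdots w_{n-1}w_0$ a cycle in $G$, indices taken modulo $n$. The family $\mathcal G_C(\mathcal A,\mathcal B)$ consists of the $2^n$ graphs obtained as follows. Delete the edges of $C$ and keep all other edges and all vertices of $G$. For each $i$, add a copy $B_i$ of $B$, with vertices $a_i,\dots,h_i$, in place of the edge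 $w_iw_{i+1}$, together with the edges $w_ia_i$ and $a_iw_{i+1}$. For each $i$, choose the supervertex $A$ or $A'$ for $w_i$: in the case of $A$, add the edges $d_{i-1}c_i$ and $h_{i-1}g_i$; in the case of $A'$, add two new vertices $w_i',w_i''$ and the edges $d_{i-1}w_i'$, $w_i'c_i$, $h_{i-1}w_i''$, $w_i''g_i$ and $w_i'w_i''$. **Theorem.** Let $G$ be a snark with a normal $5$-edge-coloring $\sigma$, and let $C$ be a cycle of even length in $G$. Then every $\tilde G\in\mathcal G_C(\mathcal A,\mathcal B)$ has a normal $5$-edge-coloring $\tilde\sigma$ such that $\tilde\sigma(e)=\sigma(e)$ for every $e\in E(G)\setminus E(C)$ and at least $18$ edges of $\tilde G$ are poor under $\tilde\sigma$. -/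

import Mathlib

/-! ### Edge-colorings, normal colorings, snarks -/

/-- A proper edge-coloring of `G` with `k` colors: a proper vertex-coloring of the line graph
of `G`, that is, a map from the edges of `G` to the colors under which any two distinct edges
with a common end-vertex have distinct colors. -/
abbrev EdgeColoring {V : Type*} (G : SimpleGraph V) (k : ℕ) : Type _ :=
  G.lineGraph.Coloring (Fin k)

/-- `palette σ v` is the set of the colors of the edges incident to the vertex `v`. -/
def palette {V : Type*} {G : SimpleGraph V} {k : ℕ} (σ : EdgeColoring G k) (v : V) :
    Set (Fin k) :=
  {c | ∃ e : G.edgeSet, v ∈ (e : Sym2 V) ∧ σ e = c}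

/-- The set of all colors that occur at the end-vertices of the edge `e`: for `e = uv` it is
the union of the palettes of `u` and `v`. -/
def edgePalette {V : Type*} {G : SimpleGraph V} {k : ℕ} (σ : EdgeColoring G k)
    (e : G.edgeSet) : Set (Fin k) :=
  {c | ∃ v : V, v ∈ (e : Sym2 V) ∧ c ∈ palette σ v}

/-- An edge is poor if exactly three colors occur at its two end-vertices. -/
def IsPoor {V : Type*} {G : SimpleGraph V} {k : ℕ} (σ : EdgeColoring G k)
    (e : G.edgeSet) : Prop :=
  (edgePalette σ e).ncard = 3

/-- An edge is rich if exactly five colors occur at its two end-vertices. -/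
def IsRich {V : Type*} {G : SimpleGraph V} {k : ℕ} (σ : EdgeColoring G k)
    (e : G.edgeSet) : Prop :=
  (edgePalette σ e).ncard = 5

/-- A (proper) edge-coloring is normal if every edge is poor or rich. -/
def IsNormalColoring {V : Type*} {G : SimpleGraph V} {k : ℕ} (σ : EdgeColoring G k) : Prop :=
  ∀ e : G.edgeSet, IsPoor σ e ∨ IsRich σ e

/-- A snark (in the broad sense): a bridgeless cubic graph that is not 3-edge-colorable.
No condition on connectivity or girth is imposed. -/
structure IsSnark {V : Type*} (G : SimpleGraph V) [G.LocallyFinite] : Prop where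
  cubic : G.IsRegularOfDegree 3
  bridgeless : ∀ e ∈ G.edgeSet, ¬ G.IsBridge e
  not_three_colorable : IsEmpty (EdgeColoring G 3)

/-! ### The Petersen graph and the superedge `B` -/

/-- Names for the ten vertices of the Petersen graph. -/
inductive PetersenVertex : Type
  | u₁ | u₂ | a | b | c | d | e | f | g | h
  deriving DecidableEq

instance : Fintype PetersenVertex where
  elems := {.u₁, .u₂, .a, .b, .c, .d, .e, .f, .g, .h}
  complete x := by cases x <;> decide

/-- The names stand for the ten 2-element subsets of a 5-element set. -/
def PetersenVertex.pair : PetersenVertex → Finset (Fin 5)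
  | u₁ => {0, 1}
  | u₂ => {0, 2}
  | a => {3, 4}
  | b => {1, 2}
  | c => {2, 3}
  | d => {1, 4}
  | e => {0, 3}
  | f => {0, 4}
  | g => {2, 4}
  | h => {1, 3}

/-- Every 2-element subset of `Fin 5` has exactly one name. -/
theorem PetersenVertex.pair_bijOn :
    Set.BijOn PetersenVertex.pair Set.univ {s : Finset (Fin 5) | s.card = 2} := by
  refine ⟨?_, ?_, ?_⟩
  · intro x _
    cases x <;> rfl
  · intro x _ y _
    revert x y
    decide
  · have key : ∀ s : Finset (Fin 5), s.card = 2 → ∃ x, PetersenVertex.pair x = s := by decide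
    intro s hs
    obtain ⟨x, hx⟩ := key s hs
    exact ⟨x, Set.mem_univ x, hx⟩

/-- The Petersen graph `P₁₀`: the 2-element subsets of a 5-element set, two of them adjacent
when they are disjoint. Its edges are `u₁a, u₁c, u₁g`, `u₂a, u₂d, u₂h` and
`ab, be, bf, cd, gh, cf, de, eg, fh`. -/
def petersen : SimpleGraph PetersenVertex where
  Adj x y := Disjoint x.pair y.pair
  symm := ⟨fun _ _ hxy => hxy.symm⟩
  loopless := ⟨fun x => by cases x <;> decide⟩

instance : DecidableRel petersen.Adj := fun x y =>
  inferInstanceAs (Decidable (Disjoint x.pair y.pair))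

/-- The vertices of the superedge `B = (P₁₀)_{u₁,u₂}`, which is the Petersen graph with the
two non-adjacent vertices `u₁`, `u₂` removed. -/
abbrev BVertex : Type := {x : PetersenVertex // x ≠ .u₁ ∧ x ≠ .u₂}

/-- The nine edges `ab, be, bf, cd, gh, cf, de, eg, fh` of the superedge `B`. Its six semiedges
are the edges of `P₁₀` at `u₁` and at `u₂`: the connector `S₁` (from `u₁`) has one semiedge at
each of `a, c, g`, the connector `S₂` (from `u₂`) has one semiedge at each of `a, d, h`. -/
def superedgeB : SimpleGraph BVertex := petersen.comap Subtype.val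

namespace BVertex

/-- The vertex `a` of `B`: it has a semiedge in both connectors. -/
def a : BVertex := ⟨.a, by decide⟩
/-- The vertex `c` of `B`: it has a semiedge in the connector `S₁`. -/
def c : BVertex := ⟨.c, by decide⟩
/-- The vertex `g` of `B`: it has a semiedge in the connector `S₁`. -/
def g : BVertex := ⟨.g, by decide⟩
/-- The vertex `d` of `B`: it has a semiedge in the connector `S₂`. -/
def d : BVertex := ⟨.d, by decide⟩
/-- The vertex `h` of `B`: it has a semiedge in the connector `S₂`. -/
def h : BVertex := ⟨.h, by decide⟩

/-- The vertices of `B` with a semiedge in `S₁` (left over from the edges of `P₁₀` at `u₁`). -/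
theorem adj_u₁_iff (x : BVertex) : petersen.Adj .u₁ x.1 ↔ x = a ∨ x = c ∨ x = g := by
  revert x
  decide

/-- The vertices of `B` with a semiedge in `S₂` (left over from the edges of `P₁₀` at `u₂`). -/
theorem adj_u₂_iff (x : BVertex) : petersen.Adj .u₂ x.1 ↔ x = a ∨ x = d ∨ x = h := by
  revert x
  decide

end BVertex

/-! ### The superpositions of a cycle -/

/-- The two supervertices, both with connectors of sizes 3, 3 and 1.
* `A` consists of one vertex `u`, incident to one semiedge of each connector, and two isolated
  edges, each of them with one semiedge in either 3-connector.
* `APrime`, the multipole `A'`, is obtained from `A` by subdividing the two isolated edges by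
  new vertices `u'` and `u''`, and by joining `u'` and `u''` by an edge. -/
inductive Supervertex : Type
  | A | APrime

/-- The vertices of the superposition of `G` along the closed walk
`C = w_0 w_1 … w_{n-1} w_0` in which the vertex `w_i` is superposed by `𝒜 i`, and
every edge `w_i w_{i+1}` of `C` by a copy `B_i` of the superedge `B`.
* `base v`: the vertex `v` of `G`, which is superposed by itself if it is not on `C`, and is
  the vertex `u` of its supervertex if it is on `C`;
* `sup i x`: the vertex `x` of the superedge `B_i`;
* `upper i`, `lower i`: the vertices `u'` and `u''` of the supervertex `𝒜 i`, which exist only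
  if it is `A'`. -/
inductive SuperVertexSet {V : Type*} {G : SimpleGraph V} {w : V} (C : G.Walk w w)
    (𝒜 : Fin C.length → Supervertex) : Type _
  | base (v : V)
  | sup (i : Fin C.length) (x : BVertex)
  | upper (i : Fin C.length) (hi : 𝒜 i = Supervertex.APrime)
  | lower (i : Fin C.length) (hi : 𝒜 i = Supervertex.APrime)

/-- `IsNext i j` says that `j = i + 1` cyclically modulo `n`, so that `B_i` and `B_j` are the
superedges attached to the two 3-connectors of the supervertex at `w_j`. -/
def IsNext {n : ℕ} (i j : Fin n) : Prop := (j : ℕ) = ((i : ℕ) + 1) % n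

/-- The edges of the superposition, each in one of its two directions. At `w_j`, let `B_i` be
the superedge of the preceding edge of `C`. The semiedges of `B_i` in `S₂` at `a, d, h` are
joined through the supervertex to the semiedges of `B_j` in `S₁` at `a, c, g` in this order.
The connection from `a` to `a` passes through `w_j`. The connections from `d` to `c` and from
`h` to `g` are the isolated edges of `A`, or those edges subdivided by `u'` and `u''` in `A'`. -/
inductive SuperLink {V : Type*} {G : SimpleGraph V} {w : V} (C : G.Walk w w)
    (𝒜 : Fin C.length → Supervertex) :
    SuperVertexSet C 𝒜 → SuperVertexSet C 𝒜 → Prop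
  /-- An edge of `G` outside `C` is superposed by itself. -/
  | keep (v v' : V) (hG : G.Adj v v') (hC : s(v, v') ∉ C.edges) :
      SuperLink C 𝒜 (.base v) (.base v')
  /-- The edges inside the superedge `B_i`. -/
  | inner (i : Fin C.length) (x y : BVertex) (hxy : superedgeB.Adj x y) :
      SuperLink C 𝒜 (.sup i x) (.sup i y)
  /-- The edge from `w_i` to the semiedge of `B_i` in `S₁` at `a`. -/
  | enter (i : Fin C.length) :
      SuperLink C 𝒜 (.base (C.getVert i)) (.sup i BVertex.a)
  /-- The edge from the semiedge of `B_i` in `S₂` at `a` to `w_{i+1}`. -/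
  | leave (i : Fin C.length) :
      SuperLink C 𝒜 (.sup i BVertex.a) (.base (C.getVert (i + 1)))
  /-- The first isolated edge of a supervertex `A`. -/
  | isolated_dc (i j : Fin C.length) (hij : IsNext i j) (hj : 𝒜 j = Supervertex.A) :
      SuperLink C 𝒜 (.sup i BVertex.d) (.sup j BVertex.c)
  /-- The second isolated edge of a supervertex `A`. -/
  | isolated_hg (i j : Fin C.length) (hij : IsNext i j) (hj : 𝒜 j = Supervertex.A) :
      SuperLink C 𝒜 (.sup i BVertex.h) (.sup j BVertex.g)
  /-- In a supervertex `A'` the vertex `u'` is joined to `d` in the preceding superedge. -/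
  | upper_d (i j : Fin C.length) (hij : IsNext i j) (hj : 𝒜 j = Supervertex.APrime) :
      SuperLink C 𝒜 (.sup i BVertex.d) (.upper j hj)
  /-- In a supervertex `A'` the vertex `u'` is joined to `c` in the following superedge. -/
  | upper_c (j : Fin C.length) (hj : 𝒜 j = Supervertex.APrime) :
      SuperLink C 𝒜 (.upper j hj) (.sup j BVertex.c)
  /-- In a supervertex `A'` the vertex `u''` is joined to `h` in the preceding superedge. -/
  | lower_h (i j : Fin C.length) (hij : IsNext i j) (hj : 𝒜 j = Supervertex.APrime) :
      SuperLink C 𝒜 (.sup i BVertex.h) (.lower j hj)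
  /-- In a supervertex `A'` the vertex `u''` is joined to `g` in the following superedge. -/
  | lower_g (j : Fin C.length) (hj : 𝒜 j = Supervertex.APrime) :
      SuperLink C 𝒜 (.lower j hj) (.sup j BVertex.g)
  /-- In a supervertex `A'` the vertices `u'` and `u''` are joined. -/
  | rung (j : Fin C.length) (hj : 𝒜 j = Supervertex.APrime) :
      SuperLink C 𝒜 (.upper j hj) (.lower j hj)

/-- The superposition of `G` along `C` given by the choice `𝒜` of the supervertices. When `C`
is a cycle, the graphs `superposition C 𝒜`, for the `2 ^ C.length` choices of `𝒜`, form the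
family `𝒢_C(𝒜, ℬ)`. -/
def superposition {V : Type*} {G : SimpleGraph V} {w : V} (C : G.Walk w w)
    (𝒜 : Fin C.length → Supervertex) : SimpleGraph (SuperVertexSet C 𝒜) :=
  SimpleGraph.fromRel (SuperLink C 𝒜)

/-- An edge of `G` outside `C`, regarded as an edge of the superposition. -/
def keptEdge {V : Type*} {G : SimpleGraph V} {w : V} (C : G.Walk w w)
    (𝒜 : Fin C.length → Supervertex) (e : G.edgeSet) (he : (e : Sym2 V) ∉ C.edges) :
    (superposition C 𝒜).edgeSet :=
  ⟨(e : Sym2 V).map SuperVertexSet.base, by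
    obtain ⟨e, heG⟩ := e
    induction e using Sym2.ind with
    | _ v v' =>
      simp only [Sym2.map_mk, SimpleGraph.mem_edgeSet, superposition,
        SimpleGraph.fromRel_adj]
      refine ⟨fun heq => ?_, Or.inl (SuperLink.keep v v' heG he)⟩
      exact G.ne_of_adj heG (SuperVertexSet.base.inj heq)⟩

/-!
The superposition `G̃` has a coloring by `G` itself: a map from the vertices of `G̃` to the vertices
of `G` and a map from the edges of `G̃` to the edges of `G` under which the three edges at each
vertex `v` of `G̃` correspond bijectively to the three edges at the image of `v`. Pulling `σ` back
along the edge map gives a proper coloring in which `v` has the palette of its image. If the ends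
of an edge of `G̃` have the same image, then they have the same palette and the edge is poor;
otherwise the image of the edge joins the images of the ends, so that the edge is poor or rich
because its image is (`GraphColoring.isNormalColoring_pullback`). Outside `C` both maps are the
identity, so the colors of the edges outside `C` are kept.

The edges at the ends of an edge `w_i w_{i+1}` of `C` are arranged as in the tree with two adjacent
vertices of degree 3 and four leaves, and the superedge `B` has a coloring by this tree
(`petersenSlot`): the vertices `c, d, e, g` go to one end, the near one, the vertices `a, b, f, h`
to the other, and the three edges between the two sets go to the middle edge. The near end is the
one with even index, so that the superedges are placed forward and backward in turn; this is where
the length of `C` has to be even. The images of the semiedges then fit together at each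
supervertex.
* At `w_j` itself, the two edges leading to `a_{j-1}` and `a_j` go to the two edges of `C` at `w_j`,
  in this order for even `j` and exchanged for odd `j`.
* For even `j`, all four semiedges at `d_{j-1}, h_{j-1}, c_j, g_j` belong to vertices with the
  image `w_j`. The first two go to the third edge `K j` at `w_j`. So do the last two in the case
  of `A`, while in the case of `A'` they go to the edge `w_{j-1} w_j`, and the edge between the two
  new vertices goes to `w_j w_{j+1}`.
* For odd `j`, the semiedges at `d_{j-1}` and `h_{j-1}` go to `w_{j-1} w_j` and `w_j w_{j+1}`. In
  the case of `A` those at `c_j` and `g_j` go to the same two edges in this order, and in the case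
  of `A'` in the other order, with the edge between the new vertices going to `K j`. An
  automorphism of `B` exchanging the two orders yields both.

Six of the nine edges of `B` join vertices with the same image, so that there are at least
`6 * C.length ≥ 24` poor edges, as an even cycle has length at least 4.
-/

/-! ### Graph colorings by a graph -/

/-- A `G`-coloring of a graph `H`: every vertex of `H` is sent to a vertex of `G` and every edge
of `H` to an edge of `G`, so that the edges at a vertex correspond bijectively to the edges at
its image. The two ends of an edge need not go to the two ends of its image: they may go to the
same end. The edge map is given by its values on ordered pairs of adjacent vertices; its values
on other pairs are irrelevant. -/
structure GraphColoring {W V : Type*} (H : SimpleGraph W) (G : SimpleGraph V) where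
  /-- The map on vertices. -/
  vert : W → V
  /-- The map on edges. -/
  label : W → W → Sym2 V
  label_comm : ∀ u v, H.Adj u v → label u v = label v u
  bijOn : ∀ v, Set.BijOn (label v) (H.neighborSet v) (G.incidenceSet (vert v))

namespace GraphColoring

variable {W V : Type*} {H : SimpleGraph W} {G : SimpleGraph V} (Φ : GraphColoring H G)

theorem label_mem {u v : W} (h : H.Adj u v) : Φ.label u v ∈ G.incidenceSet (Φ.vert u) :=
  (Φ.bijOn u).mapsTo h

/-- The image of an edge. -/
noncomputable def edge (e : H.edgeSet) : G.edgeSet :=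
  ⟨Φ.label (Quot.out (e : Sym2 W)).1 (Quot.out (e : Sym2 W)).2, by
    refine (Φ.label_mem ?_).1
    have hout : s((Quot.out (e : Sym2 W)).1, (Quot.out (e : Sym2 W)).2) = e := Quot.out_eq _
    rw [← SimpleGraph.mem_edgeSet, hout]
    exact e.2⟩

theorem edge_mk {u v : W} (h : s(u, v) ∈ H.edgeSet) :
    (Φ.edge ⟨s(u, v), h⟩ : Sym2 V) = Φ.label u v := by
  have hout : s((Quot.out s(u, v)).1, (Quot.out s(u, v)).2) = s(u, v) := Quot.out_eq _
  rcases Sym2.eq_iff.1 hout with ⟨h1, h2⟩ | ⟨h1, h2⟩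
  · change Φ.label (Quot.out s(u, v)).1 (Quot.out s(u, v)).2 = _
    rw [h1, h2]
  · change Φ.label (Quot.out s(u, v)).1 (Quot.out s(u, v)).2 = _
    rw [h1, h2]
    exact (Φ.label_comm u v h).symm

theorem vert_mem_edge {v : W} {e : H.edgeSet} (hv : v ∈ (e : Sym2 W)) :
    Φ.vert v ∈ (Φ.edge e : Sym2 V) := by
  obtain ⟨e, he⟩ := e
  obtain ⟨u, rfl⟩ := Sym2.mem_iff_exists.1 hv
  rw [edge_mk]
  exact (Φ.label_mem he).2

/-- Distinct edges with a common end have distinct images. -/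
theorem edge_injOn (v : W) : Set.InjOn Φ.edge {e | v ∈ (e : Sym2 W)} := by
  rintro ⟨e, he⟩ hv ⟨e', he'⟩ hv' heq
  obtain ⟨x, rfl⟩ := Sym2.mem_iff_exists.1 hv
  obtain ⟨y, rfl⟩ := Sym2.mem_iff_exists.1 hv'
  have h : Φ.label v x = Φ.label v y := by
    rw [← Φ.edge_mk he, ← Φ.edge_mk he', heq]
  obtain rfl := (Φ.bijOn v).injOn he he' h
  rfl

theorem exists_edge_eq (v : W) (e : G.edgeSet) (he : Φ.vert v ∈ (e : Sym2 V)) :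
    ∃ e' : H.edgeSet, v ∈ (e' : Sym2 W) ∧ Φ.edge e' = e := by
  obtain ⟨x, hx, hxe⟩ := (Φ.bijOn v).surjOn ⟨e.2, he⟩
  exact ⟨⟨s(v, x), hx⟩, Sym2.mem_mk_left _ _, Subtype.ext ((Φ.edge_mk hx).trans hxe)⟩

/-- The coloring of `H` in which every edge has the color of its image in `G`. -/
noncomputable def pullback {k : ℕ} (σ : EdgeColoring G k) : EdgeColoring H k :=
  SimpleGraph.Coloring.mk (fun e => σ (Φ.edge e)) (by
    rintro e e' ⟨hne, v, hv, hv'⟩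
    refine σ.valid ⟨fun h => hne (Φ.edge_injOn v hv hv' h), Φ.vert v, ?_, ?_⟩
    · exact Φ.vert_mem_edge hv
    · exact Φ.vert_mem_edge hv')

theorem palette_pullback {k : ℕ} (σ : EdgeColoring G k) (v : W) :
    palette (Φ.pullback σ) v = palette σ (Φ.vert v) := by
  ext c
  constructor
  · rintro ⟨e, hv, rfl⟩
    exact ⟨Φ.edge e, Φ.vert_mem_edge hv, rfl⟩
  · rintro ⟨e, he, rfl⟩
    obtain ⟨e', hv, rfl⟩ := Φ.exists_edge_eq v e he
    exact ⟨e', hv, rfl⟩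

end GraphColoring

theorem edgePalette_mk {V : Type*} {G : SimpleGraph V} {k : ℕ} (σ : EdgeColoring G k) {u v : V}
    (h : s(u, v) ∈ G.edgeSet) : edgePalette σ ⟨s(u, v), h⟩ = palette σ u ∪ palette σ v := by
  ext c
  simp [edgePalette]

theorem ncard_incidenceSet {V : Type*} {G : SimpleGraph V} [G.LocallyFinite] {d : ℕ}
    (hG : G.IsRegularOfDegree d) (v : V) : (G.incidenceSet v).ncard = d := by
  classical
  rw [← Nat.card_coe_set_eq, Nat.card_eq_fintype_card, G.card_incidenceSet_eq_degree, hG v]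

theorem ncard_palette {V : Type*} {G : SimpleGraph V} [G.LocallyFinite] {k d : ℕ}
    (hG : G.IsRegularOfDegree d) (σ : EdgeColoring G k) (v : V) : (palette σ v).ncard = d := by
  have himage : palette σ v = σ '' {e | v ∈ (e : Sym2 V)} := rfl
  have hinj : Set.InjOn σ {e : G.edgeSet | v ∈ (e : Sym2 V)} := by
    intro e he e' he' heq
    by_contra hne
    exact σ.valid (show G.lineGraph.Adj e e' from ⟨hne, v, he, he'⟩) heq
  have hsub : (Subtype.val '' {e : G.edgeSet | v ∈ (e : Sym2 V)}) = G.incidenceSet v := by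
    ext e
    simp [SimpleGraph.incidenceSet, and_comm]
  rw [himage, hinj.ncard_image,
    ← Set.ncard_image_of_injective _ Subtype.val_injective, hsub,
    ncard_incidenceSet hG]

namespace GraphColoring

variable {W V : Type*} {H : SimpleGraph W} {G : SimpleGraph V} [G.LocallyFinite]
  (Φ : GraphColoring H G)

/-- An edge whose ends have the same image is poor: both its ends have the palette of that
image. -/
theorem isPoor_of_vert_eq (hG : G.IsRegularOfDegree 3) {k : ℕ} (σ : EdgeColoring G k) {u v : W}
    (h : s(u, v) ∈ H.edgeSet) (huv : Φ.vert u = Φ.vert v) :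
    IsPoor (Φ.pullback σ) ⟨s(u, v), h⟩ := by
  rw [IsPoor, edgePalette_mk, palette_pullback, palette_pullback, huv, Set.union_self,
    ncard_palette hG]

/-- An edge whose ends have distinct images `x` and `y` is sent to the edge `xy`, so that it sees
the same colors as that edge. -/
theorem isNormalColoring_pullback (hG : G.IsRegularOfDegree 3) {k : ℕ} {σ : EdgeColoring G k}
    (hσ : IsNormalColoring σ) : IsNormalColoring (Φ.pullback σ) := by
  rintro ⟨e, he⟩
  induction e using Sym2.ind with
  | _ u v =>
    by_cases huv : Φ.vert u = Φ.vert v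
    · exact Or.inl (Φ.isPoor_of_vert_eq hG σ he huv)
    · have hu := Φ.vert_mem_edge (e := ⟨_, he⟩) (Sym2.mem_mk_left u v)
      have hv := Φ.vert_mem_edge (e := ⟨_, he⟩) (Sym2.mem_mk_right u v)
      have hmk := (Sym2.mem_and_mem_iff huv).1 ⟨hu, hv⟩
      have hmem : s(Φ.vert u, Φ.vert v) ∈ G.edgeSet := hmk ▸ (Φ.edge ⟨_, he⟩).2
      have hnormal := hσ ⟨_, hmem⟩
      rw [IsPoor, IsRich, edgePalette_mk] at hnormal
      rw [IsPoor, IsRich, edgePalette_mk, palette_pullback, palette_pullback]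
      exact hnormal

end GraphColoring

/-! ### The edges at the vertices of a cycle in a cubic graph -/

theorem coe_finRotate_eq_mod {n : ℕ} (i : Fin n) : (finRotate n i : ℕ) = ((i : ℕ) + 1) % n := by
  have := i.neZero
  rw [finRotate_apply, Fin.val_add, Fin.val_one', Nat.add_mod_mod]

theorem isNext_iff {n : ℕ} {i j : Fin n} : IsNext i j ↔ finRotate n i = j := by
  rw [IsNext, Fin.ext_iff, coe_finRotate_eq_mod, eq_comm]

theorem even_finRotate {n : ℕ} (hn : Even n) (i : Fin n) :
    Even (finRotate n i : ℕ) ↔ ¬ Even (i : ℕ) := by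
  rw [coe_finRotate_eq_mod, Nat.even_iff, Nat.mod_mod_of_dvd _ hn.two_dvd, Nat.even_iff]
  omega

theorem even_finRotate_symm {n : ℕ} (hn : Even n) (i : Fin n) :
    Even ((finRotate n).symm i : ℕ) ↔ ¬ Even (i : ℕ) := by
  have h := even_finRotate hn ((finRotate n).symm i)
  rw [Equiv.apply_symm_apply] at h
  rw [h, not_not]

theorem finRotate_ne_self {n : ℕ} (hn : 2 ≤ n) (i : Fin n) : finRotate n i ≠ i := by
  rw [Ne, Fin.ext_iff, coe_finRotate_eq_mod]
  have hi := i.2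
  rcases (show (i : ℕ) + 1 < n ∨ (i : ℕ) + 1 = n by omega) with h | h
  · rw [Nat.mod_eq_of_lt h]
    omega
  · rw [h, Nat.mod_self]
    omega

theorem finRotate_ne_finRotate_symm {n : ℕ} (hn : 3 ≤ n) (i : Fin n) :
    finRotate n i ≠ (finRotate n).symm i := by
  intro h
  rw [Equiv.eq_symm_apply, Fin.ext_iff, coe_finRotate_eq_mod, coe_finRotate_eq_mod,
    Nat.mod_add_mod] at h
  have hi := i.2
  rcases (show (i : ℕ) + 1 + 1 < n ∨ n ≤ (i : ℕ) + 1 + 1 by omega) with h' | h'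
  · rw [Nat.mod_eq_of_lt h'] at h
    omega
  · rw [Nat.mod_eq_sub_mod h', Nat.mod_eq_of_lt (by omega)] at h
    omega

section Cycle

variable {V : Type*} {G : SimpleGraph V} {w : V} (C : G.Walk w w)

theorem getVert_finRotate (i : Fin C.length) :
    C.getVert (finRotate _ i) = C.getVert (i + 1) := by
  rw [coe_finRotate_eq_mod]
  have hi := i.2
  rcases (show (i : ℕ) + 1 < C.length ∨ (i : ℕ) + 1 = C.length by omega) with h | h
  · rw [Nat.mod_eq_of_lt h]
  · rw [h, Nat.mod_self, SimpleGraph.Walk.getVert_zero, SimpleGraph.Walk.getVert_length]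

/-- The edge `w_i w_{i+1}` of the closed walk `C`. -/
def walkEdge (i : Fin C.length) : Sym2 V := s(C.getVert i, C.getVert (finRotate _ i))

theorem mem_edges_iff_walkEdge (e : Sym2 V) : e ∈ C.edges ↔ ∃ i, walkEdge C i = e := by
  rw [← SimpleGraph.Walk.mem_edges_toSubgraph]
  induction e using Sym2.ind with
  | _ u v =>
    rw [SimpleGraph.Subgraph.mem_edgeSet, SimpleGraph.Walk.toSubgraph_adj_iff]
    constructor
    · rintro ⟨i, hi, hlt⟩
      exact ⟨⟨i, hlt⟩, by rw [walkEdge, getVert_finRotate, hi]⟩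
    · rintro ⟨i, hi⟩
      exact ⟨i, by rw [← hi, walkEdge, getVert_finRotate], i.2⟩

variable {C}

theorem getVert_fin_injective (hC : C.IsCycle) :
    Function.Injective fun i : Fin C.length => C.getVert i := by
  intro i j h
  refine Fin.ext (hC.getVert_injOn' ?_ ?_ h) <;>
  · rw [Set.mem_ofPred_eq]
    omega

theorem walkEdge_symm_ne (hC : C.IsCycle) (i : Fin C.length) :
    walkEdge C ((finRotate _).symm i) ≠ walkEdge C i := by
  have hn := hC.three_le_length
  intro h
  rw [walkEdge, walkEdge, Equiv.apply_symm_apply, Sym2.eq_swap, Sym2.congr_right] at h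
  exact finRotate_ne_finRotate_symm hn i (getVert_fin_injective hC h).symm

variable (C) in
/-- Besides the two edges of `C`, the edge `e`, which is not an edge of `C`, is the only edge
at `w_i`. -/
structure IsThirdEdge (i : Fin C.length) (e : Sym2 V) : Prop where
  not_mem : e ∉ C.edges
  incidenceSet_eq :
    G.incidenceSet (C.getVert i) = {walkEdge C ((finRotate _).symm i), walkEdge C i, e}

theorem exists_isThirdEdge [G.LocallyFinite] (hG : G.IsRegularOfDegree 3) (hC : C.IsCycle)
    (i : Fin C.length) : ∃ K, IsThirdEdge C i K := by
  classical
  set v := C.getVert i with hv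
  have hcard := ncard_incidenceSet hG v
  have hmem : ∀ j, walkEdge C j ∈ G.edgeSet := fun j =>
    C.edges_subset_edgeSet ((mem_edges_iff_walkEdge C _).2 ⟨j, rfl⟩)
  have hsub : {walkEdge C ((finRotate _).symm i), walkEdge C i} ⊆ G.incidenceSet v := by
    rintro e (rfl | rfl)
    · refine ⟨hmem _, ?_⟩
      rw [walkEdge, Equiv.apply_symm_apply]
      exact Sym2.mem_mk_right _ _
    · exact ⟨hmem _, Sym2.mem_mk_left _ _⟩
  have hdiff := Set.ncard_sdiff_add_ncard_of_subset hsub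
    (Set.finite_of_ncard_ne_zero (by rw [hcard]; decide))
  rw [Set.ncard_pair (walkEdge_symm_ne hC i), hcard] at hdiff
  obtain ⟨K, hK⟩ := Set.ncard_eq_one.1
    (Nat.add_right_cancel (hdiff.trans (show 3 = 1 + 2 from rfl)))
  have hKmem : K ∈ G.incidenceSet v \ {walkEdge C ((finRotate _).symm i), walkEdge C i} :=
    hK ▸ Set.mem_singleton K
  refine ⟨K, fun hKC => ?_, ?_⟩
  · obtain ⟨j, rfl⟩ := (mem_edges_iff_walkEdge C K).1 hKC
    have hvj := hKmem.1.2
    rw [walkEdge, Sym2.mem_iff] at hvj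
    rcases hvj with h | h
    · exact hKmem.2 (Or.inr (by rw [getVert_fin_injective hC h]; rfl))
    · refine hKmem.2 (Or.inl ?_)
      rw [Equiv.symm_apply_eq _ |>.2 (getVert_fin_injective hC h)]
  · rw [← Set.sdiff_union_of_subset hsub, hK]
    ext e
    simp only [Set.mem_union, Set.mem_singleton_iff, Set.mem_insert_iff]
    tauto

end Cycle

/-! ### A coloring of the Petersen superedge by the star of an edge -/

/-- Names for the five edges of a tree with two adjacent vertices of degree 3, the near one and
the far one: the edge joining them, the two other edges at the near vertex, and the two other
edges at the far vertex. -/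
inductive Slot : Type
  | mid | near₁ | near₂ | far₁ | far₂
  deriving DecidableEq

/-- The slots of the three edges at the near vertex (`true`) or at the far vertex (`false`). -/
def Slot.IsAt : Slot → Bool → Prop
  | mid, _ => True
  | near₁, b => b = true
  | near₂, b => b = true
  | far₁, b => b = false
  | far₂, b => b = false

instance (t : Slot) (b : Bool) : Decidable (t.IsAt b) := by
  cases t <;> unfold Slot.IsAt <;> infer_instance

/-- A coloring of the Petersen superedge by the edges of the tree: the values on the edges of the
Petersen graph, those at `u₁` and `u₂` standing for the semiedges. The last case covers the edges
`be, cf, gh, u₁a, u₂d`, and also the non-adjacent pairs, whose value is junk. -/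
def petersenSlot : PetersenVertex → PetersenVertex → Slot
  | .c, .d | .d, .c | .e, .g | .g, .e => .near₁
  | .d, .e | .e, .d | .u₁, .c | .c, .u₁ | .u₁, .g | .g, .u₁ => .near₂
  | .b, .f | .f, .b | .u₂, .a | .a, .u₂ | .u₂, .h | .h, .u₂ => .far₁
  | .a, .b | .b, .a | .f, .h | .h, .f => .far₂
  | _, _ => .mid

/-- The vertices of the superedge that are sent to the near vertex of the tree. The values at `u₁`
and `u₂` are junk. -/
def isNear : PetersenVertex → Bool
  | .c | .d | .e | .g => true
  | _ => false

theorem petersenSlot_comm (x y : PetersenVertex) : petersenSlot x y = petersenSlot y x := by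
  cases x <;> cases y <;> rfl

/-- The ways in which the superedge is placed on an edge of the cycle. -/
inductive Placement : Type
  | forward | backward | backwardCrossed
  deriving DecidableEq

instance : Fintype Placement where
  elems := {.forward, .backward, .backwardCrossed}
  complete x := by cases x <;> decide

/-- The automorphism of the Petersen graph belonging to a placement. The backward ones exchange
the two connectors of the superedge, and they differ in which of `d`, `h` is exchanged
with `c`. -/
def Placement.act : Placement → PetersenVertex → PetersenVertex
  | forward, x => x
  | backward, .u₁ => .u₂
  | backward, .u₂ => .u₁
  | backward, .a => .a
  | backward, .b => .b
  | backward, .c => .d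
  | backward, .d => .c
  | backward, .e => .f
  | backward, .f => .e
  | backward, .g => .h
  | backward, .h => .g
  | backwardCrossed, .u₁ => .u₂
  | backwardCrossed, .u₂ => .u₁
  | backwardCrossed, .a => .a
  | backwardCrossed, .b => .b
  | backwardCrossed, .c => .h
  | backwardCrossed, .h => .c
  | backwardCrossed, .d => .g
  | backwardCrossed, .g => .d
  | backwardCrossed, .e => .e
  | backwardCrossed, .f => .f

theorem Placement.act_act (t : Placement) (x : PetersenVertex) : t.act (t.act x) = x := by
  cases t <;> cases x <;> rfl

theorem Placement.act_injective (t : Placement) : Function.Injective t.act :=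
  Function.LeftInverse.injective t.act_act

theorem Placement.adj_act (t : Placement) (x y : PetersenVertex) :
    petersen.Adj (t.act x) (t.act y) ↔ petersen.Adj x y := by
  revert t x y
  decide

/-- At every vertex of the superedge, `petersenSlot` is a bijection from the three edges and
semiedges there to the edges at the image of the vertex in the tree. -/
theorem petersenSlot_bijOn (x : PetersenVertex) (hx : x ≠ .u₁ ∧ x ≠ .u₂) :
    Set.BijOn (petersenSlot x) (petersen.neighborSet x) {t | t.IsAt (isNear x)} := by
  have hmaps : ∀ x : PetersenVertex, x ≠ .u₁ ∧ x ≠ .u₂ → ∀ y, petersen.Adj x y →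
      (petersenSlot x y).IsAt (isNear x) := by decide
  have hinj : ∀ x : PetersenVertex, x ≠ .u₁ ∧ x ≠ .u₂ → ∀ y, petersen.Adj x y →
      ∀ z, petersen.Adj x z → petersenSlot x y = petersenSlot x z → y = z := by decide
  have hsurj : ∀ x : PetersenVertex, x ≠ .u₁ ∧ x ≠ .u₂ →
      (Slot.IsAt .mid (isNear x) → ∃ y, petersen.Adj x y ∧ petersenSlot x y = .mid) ∧
      (Slot.IsAt .near₁ (isNear x) → ∃ y, petersen.Adj x y ∧ petersenSlot x y = .near₁) ∧
      (Slot.IsAt .near₂ (isNear x) → ∃ y, petersen.Adj x y ∧ petersenSlot x y = .near₂) ∧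
      (Slot.IsAt .far₁ (isNear x) → ∃ y, petersen.Adj x y ∧ petersenSlot x y = .far₁) ∧
      (Slot.IsAt .far₂ (isNear x) → ∃ y, petersen.Adj x y ∧ petersenSlot x y = .far₂) := by
    decide
  obtain ⟨h1, h2, h3, h4, h5⟩ := hsurj x hx
  refine ⟨fun y hy => hmaps x hx y hy, fun y hy z hz => hinj x hx y hy z hz, fun t ht => ?_⟩
  cases t
  exacts [h1 ht, h2 ht, h3 ht, h4 ht, h5 ht]

/-- The coloring `petersenSlot` turned around by an automorphism. -/
def Placement.slot (t : Placement) (x y : PetersenVertex) : Slot :=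
  petersenSlot (t.act x) (t.act y)

theorem Placement.slot_comm (t : Placement) (x y : PetersenVertex) :
    t.slot x y = t.slot y x :=
  petersenSlot_comm _ _

theorem Set.BijOn.of_lift {α β γ : Type*} {f : α → γ} {g : β → γ} {s : Set α} {t : Set β}
    {r : Set γ} (hf : Set.BijOn f s r) (o : α → β) (hmaps : ∀ a ∈ s, o a ∈ t)
    (hg : ∀ a ∈ s, g (o a) = f a) (hsurj : ∀ b ∈ t, ∃ a ∈ s, o a = b) : Set.BijOn g t r := by
  refine ⟨?_, ?_, ?_⟩
  · intro b hb
    obtain ⟨a, ha, rfl⟩ := hsurj b hb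
    rw [hg a ha]
    exact hf.mapsTo ha
  · intro b hb b' hb' h
    obtain ⟨a, ha, rfl⟩ := hsurj b hb
    obtain ⟨a', ha', rfl⟩ := hsurj b' hb'
    rw [hg a ha, hg a' ha'] at h
    rw [hf.injOn ha ha' h]
  · intro c hc
    obtain ⟨a, ha, rfl⟩ := hf.surjOn hc
    exact ⟨o a, hmaps a ha, hg a ha⟩

theorem Placement.slot_bijOn (t : Placement) (x : PetersenVertex) (hx : x ≠ .u₁ ∧ x ≠ .u₂) :
    Set.BijOn (t.slot x) (petersen.neighborSet x) {s | s.IsAt (isNear (t.act x))} := by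
  have hx' : t.act x ≠ .u₁ ∧ t.act x ≠ .u₂ := by
    revert t x
    decide
  refine (petersenSlot_bijOn (t.act x) hx').of_lift t.act (fun y hy => ?_) (fun y _ => ?_)
    (fun y hy => ⟨t.act y, (t.adj_act x y).2 hy, t.act_act y⟩)
  · rw [SimpleGraph.mem_neighborSet, ← t.adj_act, t.act_act]
    exact hy
  · rw [Placement.slot, t.act_act]

/-- If a set of three elements is `{f x, f y, f z}`, then `f` is a bijection
from `{x, y, z}` to it. -/
theorem Set.bijOn_triple {α β : Type*} {f : α → β} {s : Set α} {r : Set β} {x y z : α}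
    (hs : s = {x, y, z}) (hr : r = {f x, f y, f z}) (hcard : r.ncard = 3) :
    Set.BijOn f s r := by
  have himage : f '' s = r := by
    rw [hs, hr, Set.image_insert_eq, Set.image_insert_eq, Set.image_singleton]
  have hfin : s.Finite := hs ▸ Set.toFinite _
  have hle : s.ncard ≤ 3 := by
    rw [hs]
    exact Set.ncard_insert_le _ _ |>.trans (Nat.succ_le_succ (Set.ncard_insert_le _ _ |>.trans
      (by rw [Set.ncard_singleton])))
  have hinj : Set.InjOn f s := by
    refine Set.injOn_of_ncard_image_eq ?_ hfin
    refine le_antisymm (Set.ncard_image_le hfin) ?_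
    rw [himage, hcard]
    exact hle
  exact himage ▸ hinj.bijOn_image

/-! ### The edges at each vertex of the superposition -/

section Adjacency

variable {V : Type*} {G : SimpleGraph V} {w : V} {C : G.Walk w w} {𝒜 : Fin C.length → Supervertex}

instance [Finite V] : Finite (SuperVertexSet C 𝒜) := by
  let code : SuperVertexSet C 𝒜 → (V ⊕ Fin C.length × BVertex) ⊕ (Fin C.length ⊕ Fin C.length)
    | .base v => .inl (.inl v)
    | .sup i x => .inl (.inr (i, x))
    | .upper i _ => .inr (.inl i)
    | .lower i _ => .inr (.inr i)
  refine Finite.of_injective code ?_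
  rintro (_ | _ | _ | _) (_ | _ | _ | _) h <;> simp_all [code]

theorem superposition_adj {u v : SuperVertexSet C 𝒜} :
    (superposition C 𝒜).Adj u v ↔ u ≠ v ∧ (SuperLink C 𝒜 u v ∨ SuperLink C 𝒜 v u) :=
  SimpleGraph.fromRel_adj _ _ _

/-- The vertex to which the semiedge of `B_i` in `S₁` at `x` leads, for `x` one of `a, c, g`. -/
def leftEnd (𝒜 : Fin C.length → Supervertex) (i : Fin C.length) (x : BVertex) :
    SuperVertexSet C 𝒜 :=
  if x = BVertex.a then .base (C.getVert i)
  else match h : 𝒜 i with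
    | .A => .sup ((finRotate _).symm i) (if x = BVertex.c then BVertex.d else BVertex.h)
    | .APrime => if x = BVertex.c then .upper i h else .lower i h

/-- The vertex to which the semiedge of `B_i` in `S₂` at `x` leads, for `x` one of `a, d, h`. -/
def rightEnd (𝒜 : Fin C.length → Supervertex) (i : Fin C.length) (x : BVertex) :
    SuperVertexSet C 𝒜 :=
  if x = BVertex.a then .base (C.getVert (finRotate _ i))
  else match h : 𝒜 (finRotate _ i) with
    | .A => .sup (finRotate _ i) (if x = BVertex.d then BVertex.c else BVertex.g)
    | .APrime => if x = BVertex.d then .upper _ h else .lower _ h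

/-- The other end of the edge that corresponds, at the vertex `x` of `B_i`, to the edge `xy` of
the Petersen graph. -/
def outEnd (𝒜 : Fin C.length → Supervertex) (i : Fin C.length) (x : BVertex)
    (y : PetersenVertex) : SuperVertexSet C 𝒜 :=
  if hy : y ≠ .u₁ ∧ y ≠ .u₂ then .sup i ⟨y, hy⟩
  else if y = .u₁ then leftEnd 𝒜 i x else rightEnd 𝒜 i x

theorem leftEnd_c_of_A {i : Fin C.length} (h : 𝒜 i = .A) :
    leftEnd 𝒜 i BVertex.c = .sup ((finRotate _).symm i) BVertex.d := by
  rw [leftEnd, if_neg (by decide)]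
  split
  · rw [if_pos rfl]
  · next h' => exact absurd (h.symm.trans h') nofun

theorem leftEnd_g_of_A {i : Fin C.length} (h : 𝒜 i = .A) :
    leftEnd 𝒜 i BVertex.g = .sup ((finRotate _).symm i) BVertex.h := by
  rw [leftEnd, if_neg (by decide)]
  split
  · rw [if_neg (by decide)]
  · next h' => exact absurd (h.symm.trans h') nofun

theorem leftEnd_c_of_APrime {i : Fin C.length} (h : 𝒜 i = .APrime) :
    leftEnd 𝒜 i BVertex.c = .upper i h := by
  rw [leftEnd, if_neg (by decide)]
  split
  · next h' => exact absurd (h.symm.trans h') nofun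
  · rw [if_pos rfl]

theorem leftEnd_g_of_APrime {i : Fin C.length} (h : 𝒜 i = .APrime) :
    leftEnd 𝒜 i BVertex.g = .lower i h := by
  rw [leftEnd, if_neg (by decide)]
  split
  · next h' => exact absurd (h.symm.trans h') nofun
  · rw [if_neg (by decide)]

theorem rightEnd_d_of_A {i : Fin C.length} (h : 𝒜 (finRotate _ i) = .A) :
    rightEnd 𝒜 i BVertex.d = .sup (finRotate _ i) BVertex.c := by
  rw [rightEnd, if_neg (by decide)]
  split
  · rw [if_pos rfl]
  · next h' => exact absurd (h.symm.trans h') nofun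

theorem rightEnd_h_of_A {i : Fin C.length} (h : 𝒜 (finRotate _ i) = .A) :
    rightEnd 𝒜 i BVertex.h = .sup (finRotate _ i) BVertex.g := by
  rw [rightEnd, if_neg (by decide)]
  split
  · rw [if_neg (by decide)]
  · next h' => exact absurd (h.symm.trans h') nofun

theorem rightEnd_d_of_APrime {i : Fin C.length} (h : 𝒜 (finRotate _ i) = .APrime) :
    rightEnd 𝒜 i BVertex.d = .upper _ h := by
  rw [rightEnd, if_neg (by decide)]
  split
  · next h' => exact absurd (h.symm.trans h') nofun
  · rw [if_pos rfl]

theorem rightEnd_h_of_APrime {i : Fin C.length} (h : 𝒜 (finRotate _ i) = .APrime) :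
    rightEnd 𝒜 i BVertex.h = .lower _ h := by
  rw [rightEnd, if_neg (by decide)]
  split
  · next h' => exact absurd (h.symm.trans h') nofun
  · rw [if_neg (by decide)]

theorem outEnd_u₁ (i : Fin C.length) (x : BVertex) : outEnd 𝒜 i x .u₁ = leftEnd 𝒜 i x := rfl

theorem outEnd_u₂ (i : Fin C.length) (x : BVertex) : outEnd 𝒜 i x .u₂ = rightEnd 𝒜 i x := rfl

theorem outEnd_coe (i : Fin C.length) (x y : BVertex) : outEnd 𝒜 i x y.1 = .sup i y :=
  dif_pos y.2

/-- Every edge of the superposition at `x` in `B_i` corresponds to an edge of the Petersen graph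
at `x`. -/
theorem exists_outEnd_eq {i : Fin C.length} {x : BVertex} {u : SuperVertexSet C 𝒜}
    (h : (superposition C 𝒜).Adj (.sup i x) u) : ∃ y, petersen.Adj x.1 y ∧ outEnd 𝒜 i x y = u := by
  rcases (superposition_adj.1 h).2 with h | h
  · cases h with
    | inner _ _ y hxy => exact ⟨y.1, hxy, outEnd_coe _ _ _⟩
    | leave =>
      refine ⟨.u₂, by decide, ?_⟩
      rw [outEnd_u₂, rightEnd, if_pos rfl, getVert_finRotate]
    | isolated_dc _ j hij hj =>
      obtain rfl := isNext_iff.1 hij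
      exact ⟨.u₂, by decide, rightEnd_d_of_A hj⟩
    | isolated_hg _ j hij hj =>
      obtain rfl := isNext_iff.1 hij
      exact ⟨.u₂, by decide, rightEnd_h_of_A hj⟩
    | upper_d _ j hij hj =>
      obtain rfl := isNext_iff.1 hij
      exact ⟨.u₂, by decide, rightEnd_d_of_APrime hj⟩
    | lower_h _ j hij hj =>
      obtain rfl := isNext_iff.1 hij
      exact ⟨.u₂, by decide, rightEnd_h_of_APrime hj⟩
  · cases h with
    | inner _ y _ hxy => exact ⟨y.1, hxy.symm, outEnd_coe _ _ _⟩
    | enter => exact ⟨.u₁, by decide, (if_pos rfl : leftEnd 𝒜 i BVertex.a = _)⟩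
    | isolated_dc j _ hij hj =>
      obtain rfl := (Equiv.symm_apply_eq _).2 (isNext_iff.1 hij).symm
      exact ⟨.u₁, by decide, leftEnd_c_of_A hj⟩
    | isolated_hg j _ hij hj =>
      obtain rfl := (Equiv.symm_apply_eq _).2 (isNext_iff.1 hij).symm
      exact ⟨.u₁, by decide, leftEnd_g_of_A hj⟩
    | upper_c _ hj => exact ⟨.u₁, by decide, leftEnd_c_of_APrime hj⟩
    | lower_g _ hj => exact ⟨.u₁, by decide, leftEnd_g_of_APrime hj⟩

theorem superLink_adj {u v : SuperVertexSet C 𝒜} (hne : u ≠ v) (h : SuperLink C 𝒜 u v) :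
    (superposition C 𝒜).Adj u v :=
  superposition_adj.2 ⟨hne, Or.inl h⟩

theorem superLink_adj_symm {u v : SuperVertexSet C 𝒜} (hne : u ≠ v) (h : SuperLink C 𝒜 v u) :
    (superposition C 𝒜).Adj u v :=
  superposition_adj.2 ⟨hne, Or.inr h⟩

theorem isNext_finRotate {n : ℕ} (i : Fin n) : IsNext i (finRotate n i) :=
  isNext_iff.2 rfl

theorem isNext_finRotate_symm {n : ℕ} (i : Fin n) : IsNext ((finRotate n).symm i) i :=
  isNext_iff.2 (Equiv.apply_symm_apply _ _)

theorem Supervertex.eq_A_or_eq_APrime (s : Supervertex) : s = .A ∨ s = .APrime := by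
  cases s
  exacts [Or.inl rfl, Or.inr rfl]

theorem adj_outEnd {i : Fin C.length} {x : BVertex} {y : PetersenVertex}
    (h : petersen.Adj x.1 y) : (superposition C 𝒜).Adj (.sup i x) (outEnd 𝒜 i x y) := by
  by_cases hy : y ≠ .u₁ ∧ y ≠ .u₂
  · rw [outEnd, dif_pos hy]
    refine superLink_adj (fun heq => ?_) (.inner i x ⟨y, hy⟩ h)
    obtain rfl := (SuperVertexSet.sup.inj heq).2
    exact petersen.loopless.irrefl _ h
  rcases (show y = .u₁ ∨ y = .u₂ by tauto) with rfl | rfl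
  · rw [outEnd_u₁]
    rcases (BVertex.adj_u₁_iff x).1 h.symm with rfl | rfl | rfl
    · exact superLink_adj_symm nofun (.enter i)
    · rcases (𝒜 i).eq_A_or_eq_APrime with hA | hA
      · rw [leftEnd_c_of_A hA]
        refine superLink_adj_symm ?_ (.isolated_dc _ i (isNext_finRotate_symm i) hA)
        exact fun heq => absurd (SuperVertexSet.sup.inj heq).2 (by decide)
      · rw [leftEnd_c_of_APrime hA]
        exact superLink_adj_symm nofun (.upper_c i hA)
    · rcases (𝒜 i).eq_A_or_eq_APrime with hA | hA
      · rw [leftEnd_g_of_A hA]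
        refine superLink_adj_symm ?_ (.isolated_hg _ i (isNext_finRotate_symm i) hA)
        exact fun heq => absurd (SuperVertexSet.sup.inj heq).2 (by decide)
      · rw [leftEnd_g_of_APrime hA]
        exact superLink_adj_symm nofun (.lower_g i hA)
  · rw [outEnd_u₂]
    rcases (BVertex.adj_u₂_iff x).1 h.symm with rfl | rfl | rfl
    · rw [rightEnd, if_pos rfl, getVert_finRotate]
      exact superLink_adj nofun (.leave i)
    · rcases (𝒜 (finRotate _ i)).eq_A_or_eq_APrime with hA | hA
      · rw [rightEnd_d_of_A hA]
        refine superLink_adj ?_ (.isolated_dc i _ (isNext_finRotate i) hA)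
        exact fun heq => absurd (SuperVertexSet.sup.inj heq).2 (by decide)
      · rw [rightEnd_d_of_APrime hA]
        exact superLink_adj nofun (.upper_d i _ (isNext_finRotate i) hA)
    · rcases (𝒜 (finRotate _ i)).eq_A_or_eq_APrime with hA | hA
      · rw [rightEnd_h_of_A hA]
        refine superLink_adj ?_ (.isolated_hg i _ (isNext_finRotate i) hA)
        exact fun heq => absurd (SuperVertexSet.sup.inj heq).2 (by decide)
      · rw [rightEnd_h_of_APrime hA]
        exact superLink_adj nofun (.lower_h i _ (isNext_finRotate i) hA)

theorem neighborSet_upper {j : Fin C.length} (hj : 𝒜 j = .APrime) :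
    (superposition C 𝒜).neighborSet (.upper j hj) =
      {.sup ((finRotate _).symm j) BVertex.d, .sup j BVertex.c, .lower j hj} := by
  ext u
  constructor
  · intro h
    rcases (superposition_adj.1 h).2 with h | h
    · cases h with
      | upper_c => exact Or.inr (Or.inl rfl)
      | rung => exact Or.inr (Or.inr rfl)
    · cases h with
      | upper_d i _ hij =>
        obtain rfl := (Equiv.symm_apply_eq _).2 (isNext_iff.1 hij).symm
        exact Or.inl rfl
  · rintro (rfl | rfl | rfl)
    · exact superLink_adj_symm nofun (.upper_d _ j (isNext_finRotate_symm j) hj)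
    · exact superLink_adj nofun (.upper_c j hj)
    · exact superLink_adj nofun (.rung j hj)

theorem neighborSet_lower {j : Fin C.length} (hj : 𝒜 j = .APrime) :
    (superposition C 𝒜).neighborSet (.lower j hj) =
      {.sup ((finRotate _).symm j) BVertex.h, .sup j BVertex.g, .upper j hj} := by
  ext u
  constructor
  · intro h
    rcases (superposition_adj.1 h).2 with h | h
    · cases h with
      | lower_g => exact Or.inr (Or.inl rfl)
    · cases h with
      | lower_h i _ hij =>
        obtain rfl := (Equiv.symm_apply_eq _).2 (isNext_iff.1 hij).symm
        exact Or.inl rfl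
      | rung => exact Or.inr (Or.inr rfl)
  · rintro (rfl | rfl | rfl)
    · exact superLink_adj_symm nofun (.lower_h _ j (isNext_finRotate_symm j) hj)
    · exact superLink_adj nofun (.lower_g j hj)
    · exact superLink_adj_symm nofun (.rung j hj)

theorem adj_base_iff {v : V} {u : SuperVertexSet C 𝒜} :
    (superposition C 𝒜).Adj (.base v) u ↔
      (∃ v', u = .base v' ∧ G.Adj v v' ∧ s(v, v') ∉ C.edges) ∨
      (∃ i : Fin C.length, v = C.getVert i ∧ u = .sup i BVertex.a) ∨
      ∃ i : Fin C.length, v = C.getVert (finRotate _ i) ∧ u = .sup i BVertex.a := by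
  constructor
  · intro h
    rcases (superposition_adj.1 h).2 with h | h
    · cases h with
      | keep _ v' hG hC => exact Or.inl ⟨v', rfl, hG, hC⟩
      | enter i => exact Or.inr (Or.inl ⟨i, rfl, rfl⟩)
    · cases h with
      | keep v' _ hG hC => exact Or.inl ⟨v', rfl, hG.symm, Sym2.eq_swap ▸ hC⟩
      | leave i => exact Or.inr (Or.inr ⟨i, (getVert_finRotate C i).symm, rfl⟩)
  · rintro (⟨v', rfl, hG, hC⟩ | ⟨i, rfl, rfl⟩ | ⟨i, rfl, rfl⟩)
    · exact superLink_adj (fun h => hG.ne (SuperVertexSet.base.inj h)) (.keep v v' hG hC)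
    · exact superLink_adj nofun (.enter i)
    · rw [getVert_finRotate]
      exact superLink_adj_symm nofun (.leave i)

end Adjacency

/-! ### The coloring of the superposition by the original graph -/

section Labels

variable {V : Type*} {G : SimpleGraph V} {w : V} {C : G.Walk w w} (𝒜 : Fin C.length → Supervertex)
  (K : Fin C.length → Sym2 V)

/-- The placement of the superedge `B_i`. The supervertex at `w_i` matters only for odd `i`. -/
def placement (i : Fin C.length) : Placement :=
  if Even (i : ℕ) then .forward
  else match 𝒜 i with
    | .A => .backwardCrossed
    | .APrime => .backward

/-- The end of the edge `w_i w_{i+1}` that plays the near vertex (`true`) or the far vertex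
(`false`) for `B_i`: the near vertex is the one with even index. -/
def slotVert (C : G.Walk w w) (i : Fin C.length) (b : Bool) : V :=
  if Even (i : ℕ) then bif b then C.getVert i else C.getVert (finRotate _ i)
  else bif b then C.getVert (finRotate _ i) else C.getVert i

/-- The edge of `G` in a slot of the superedge `B_i`; the middle edge is `w_i w_{i+1}`. Here
`K j` is the third edge at `w_j`. For even `i`, the semiedges at `c` and `g` have the slot `near₂`,
so that the supervertex at `w_i` decides which of the two remaining edges at `w_i` it holds. -/
def slotEdge (i : Fin C.length) : Slot → Sym2 V
  | .mid => walkEdge C i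
  | .near₁ =>
    if Even (i : ℕ) then
      match 𝒜 i with
      | .A => walkEdge C ((finRotate _).symm i)
      | .APrime => K i
    else walkEdge C (finRotate _ i)
  | .near₂ =>
    if Even (i : ℕ) then
      match 𝒜 i with
      | .A => K i
      | .APrime => walkEdge C ((finRotate _).symm i)
    else K (finRotate _ i)
  | .far₁ =>
    if Even (i : ℕ) then walkEdge C (finRotate _ i) else walkEdge C ((finRotate _).symm i)
  | .far₂ => if Even (i : ℕ) then K (finRotate _ i) else K i

/-- The image of the edge `xy` of `B_i`, or of a semiedge at `x` if `y` is `u₁` or `u₂`. -/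
def innerLabel (i : Fin C.length) (x y : PetersenVertex) : Sym2 V :=
  slotEdge 𝒜 K i ((placement 𝒜 i).slot x y)

/-- The image of the semiedge of `B_i` at `x`, for `x` one of `c, d, g, h`. -/
def semiLabel (i : Fin C.length) (x : BVertex) : Sym2 V :=
  if x = BVertex.c ∨ x = BVertex.g then innerLabel 𝒜 K i .u₁ x.1 else innerLabel 𝒜 K i .u₂ x.1

/-- The image of the edge joining the two additional vertices of a supervertex `A'`. -/
def rungLabel (K : Fin C.length → Sym2 V) (j : Fin C.length) : Sym2 V :=
  if Even (j : ℕ) then walkEdge C j else K j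

open Classical in
/-- The image of an edge of the superposition. The values on non-adjacent pairs are junk. An edge
between two superedges gets the image of its semiedge at the first end. -/
noncomputable def superLabel : SuperVertexSet C 𝒜 → SuperVertexSet C 𝒜 → Sym2 V
  | .base v, .base v' => s(v, v')
  | .base v, .sup i x | .sup i x, .base v =>
    if v = C.getVert i then innerLabel 𝒜 K i .u₁ x.1 else innerLabel 𝒜 K i .u₂ x.1
  | .sup i x, .sup j y => if i = j then innerLabel 𝒜 K i x.1 y.1 else semiLabel 𝒜 K i x
  | .sup i x, .upper _ _ | .upper _ _, .sup i x => semiLabel 𝒜 K i x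
  | .sup i x, .lower _ _ | .lower _ _, .sup i x => semiLabel 𝒜 K i x
  | .upper j _, _ => rungLabel K j
  | .lower j _, _ => rungLabel K j
  | .base v, _ => s(v, v)

/-- The image of a vertex of the superposition. -/
def superVert : SuperVertexSet C 𝒜 → V
  | .base v => v
  | .sup i x => slotVert C i (isNear ((placement 𝒜 i).act x.1))
  | .upper j _ => C.getVert j
  | .lower j _ => C.getVert j

variable {𝒜 K}

theorem innerLabel_comm (i : Fin C.length) (x y : PetersenVertex) :
    innerLabel 𝒜 K i x y = innerLabel 𝒜 K i y x := by
  rw [innerLabel, Placement.slot_comm, innerLabel]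

theorem innerLabel_u₁_a_of_even {i : Fin C.length} (h : Even (i : ℕ)) :
    innerLabel 𝒜 K i .u₁ .a = walkEdge C i := by
  rw [innerLabel, placement, if_pos h]
  rfl

theorem innerLabel_u₂_a_of_even {i : Fin C.length} (h : Even (i : ℕ)) :
    innerLabel 𝒜 K i .u₂ .a = walkEdge C (finRotate _ i) := by
  rw [innerLabel, placement, if_pos h]
  exact if_pos h

theorem innerLabel_u₁_a_of_not_even {i : Fin C.length} (h : ¬ Even (i : ℕ)) :
    innerLabel 𝒜 K i .u₁ .a = walkEdge C ((finRotate _).symm i) := by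
  rw [innerLabel, placement, if_neg h]
  rcases (𝒜 i).eq_A_or_eq_APrime with hA | hA <;> rw [hA] <;> exact if_neg h

theorem innerLabel_u₂_a_of_not_even {i : Fin C.length} (h : ¬ Even (i : ℕ)) :
    innerLabel 𝒜 K i .u₂ .a = walkEdge C i := by
  rw [innerLabel, placement, if_neg h]
  rcases (𝒜 i).eq_A_or_eq_APrime with hA | hA <;> rw [hA] <;> rfl

theorem semiLabel_d_of_even {i : Fin C.length} (h : Even (i : ℕ)) :
    semiLabel 𝒜 K i BVertex.d = walkEdge C i := by
  rw [semiLabel, if_neg (by decide), innerLabel, placement, if_pos h]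
  rfl

theorem semiLabel_h_of_even {i : Fin C.length} (h : Even (i : ℕ)) :
    semiLabel 𝒜 K i BVertex.h = walkEdge C (finRotate _ i) := by
  rw [semiLabel, if_neg (by decide), innerLabel, placement, if_pos h]
  exact if_pos h

theorem semiLabel_d_of_not_even {i : Fin C.length} (h : ¬ Even (i : ℕ)) :
    semiLabel 𝒜 K i BVertex.d = K (finRotate _ i) := by
  rw [semiLabel, if_neg (by decide), innerLabel, placement, if_neg h]
  rcases (𝒜 i).eq_A_or_eq_APrime with hA | hA <;> rw [hA] <;> exact if_neg h

theorem semiLabel_h_of_not_even {i : Fin C.length} (h : ¬ Even (i : ℕ)) :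
    semiLabel 𝒜 K i BVertex.h = K (finRotate _ i) := by
  rw [semiLabel, if_neg (by decide), innerLabel, placement, if_neg h]
  rcases (𝒜 i).eq_A_or_eq_APrime with hA | hA <;> rw [hA] <;> exact if_neg h

theorem slotEdge_near₂_of_A {i : Fin C.length} (h : Even (i : ℕ)) (hA : 𝒜 i = .A) :
    slotEdge 𝒜 K i .near₂ = K i := by
  rw [slotEdge, if_pos h, hA]

theorem slotEdge_near₂_of_APrime {i : Fin C.length} (h : Even (i : ℕ)) (hA : 𝒜 i = .APrime) :
    slotEdge 𝒜 K i .near₂ = walkEdge C ((finRotate _).symm i) := by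
  rw [slotEdge, if_pos h, hA]

theorem semiLabel_c_of_even {i : Fin C.length} (h : Even (i : ℕ)) :
    semiLabel 𝒜 K i BVertex.c = slotEdge 𝒜 K i .near₂ := by
  rw [semiLabel, if_pos (by decide), innerLabel, placement, if_pos h]
  rfl

theorem semiLabel_g_of_even {i : Fin C.length} (h : Even (i : ℕ)) :
    semiLabel 𝒜 K i BVertex.g = slotEdge 𝒜 K i .near₂ := by
  rw [semiLabel, if_pos (by decide), innerLabel, placement, if_pos h]
  rfl

theorem semiLabel_c_of_A {i : Fin C.length} (h : ¬ Even (i : ℕ)) (hA : 𝒜 i = .A) :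
    semiLabel 𝒜 K i BVertex.c = walkEdge C ((finRotate _).symm i) := by
  rw [semiLabel, if_pos (by decide), innerLabel, placement, if_neg h, hA]
  exact if_neg h

theorem semiLabel_g_of_A {i : Fin C.length} (h : ¬ Even (i : ℕ)) (hA : 𝒜 i = .A) :
    semiLabel 𝒜 K i BVertex.g = walkEdge C i := by
  rw [semiLabel, if_pos (by decide), innerLabel, placement, if_neg h, hA]
  rfl

theorem semiLabel_c_of_APrime {i : Fin C.length} (h : ¬ Even (i : ℕ)) (hA : 𝒜 i = .APrime) :
    semiLabel 𝒜 K i BVertex.c = walkEdge C i := by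
  rw [semiLabel, if_pos (by decide), innerLabel, placement, if_neg h, hA]
  rfl

theorem semiLabel_g_of_APrime {i : Fin C.length} (h : ¬ Even (i : ℕ)) (hA : 𝒜 i = .APrime) :
    semiLabel 𝒜 K i BVertex.g = walkEdge C ((finRotate _).symm i) := by
  rw [semiLabel, if_pos (by decide), innerLabel, placement, if_neg h, hA]
  exact if_neg h

/-- The two semiedges joined by the first isolated edge of a supervertex `A` have the same
image. -/
theorem semiLabel_d_eq_semiLabel_c (hn : Even C.length) {i : Fin C.length}
    (hA : 𝒜 (finRotate _ i) = .A) :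
    semiLabel 𝒜 K i BVertex.d = semiLabel 𝒜 K (finRotate _ i) BVertex.c := by
  by_cases h : Even (i : ℕ)
  · have h' := mt (even_finRotate hn i).1 (not_not.2 h)
    rw [semiLabel_d_of_even h, semiLabel_c_of_A h' hA, Equiv.symm_apply_apply]
  · have h' := (even_finRotate hn i).2 h
    rw [semiLabel_d_of_not_even h, semiLabel_c_of_even h', slotEdge_near₂_of_A h' hA]

/-- The two semiedges joined by the second isolated edge of a supervertex `A` have the same
image. -/
theorem semiLabel_h_eq_semiLabel_g (hn : Even C.length) {i : Fin C.length}
    (hA : 𝒜 (finRotate _ i) = .A) :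
    semiLabel 𝒜 K i BVertex.h = semiLabel 𝒜 K (finRotate _ i) BVertex.g := by
  by_cases h : Even (i : ℕ)
  · have h' := mt (even_finRotate hn i).1 (not_not.2 h)
    rw [semiLabel_h_of_even h, semiLabel_g_of_A h' hA]
  · have h' := (even_finRotate hn i).2 h
    rw [semiLabel_h_of_not_even h, semiLabel_g_of_even h', slotEdge_near₂_of_A h' hA]

theorem superLabel_comm_of_superLink (hC : C.IsCycle) (hn : Even C.length)
    {u v : SuperVertexSet C 𝒜} (h : SuperLink C 𝒜 u v) :
    superLabel 𝒜 K u v = superLabel 𝒜 K v u := by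
  have hne := finRotate_ne_self (by have := hC.three_le_length; omega : 2 ≤ C.length)
  cases h with
  | keep v v' => exact Sym2.eq_swap
  | inner i x y => simp only [superLabel, if_pos, innerLabel_comm i x.1 y.1]
  | isolated_dc i j hij hj =>
    obtain rfl := isNext_iff.1 hij
    rw [superLabel, superLabel, if_neg (hne i).symm, if_neg (hne i)]
    exact semiLabel_d_eq_semiLabel_c hn hj
  | isolated_hg i j hij hj =>
    obtain rfl := isNext_iff.1 hij
    rw [superLabel, superLabel, if_neg (hne i).symm, if_neg (hne i)]
    exact semiLabel_h_eq_semiLabel_g hn hj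
  | enter | leave | upper_d | upper_c | lower_h | lower_g | rung => rfl

theorem superLabel_comm (hC : C.IsCycle) (hn : Even C.length) {u v : SuperVertexSet C 𝒜}
    (h : (superposition C 𝒜).Adj u v) : superLabel 𝒜 K u v = superLabel 𝒜 K v u := by
  rcases (superposition_adj.1 h).2 with h | h
  · exact superLabel_comm_of_superLink hC hn h
  · exact (superLabel_comm_of_superLink hC hn h).symm

/-- At a vertex `x` of `B_i`, the image of every edge of the superposition is that of the
corresponding edge or semiedge of `B_i`. -/
theorem superLabel_outEnd (hC : C.IsCycle) {i : Fin C.length} {x : BVertex} {y : PetersenVertex}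
    (h : petersen.Adj x.1 y) :
    superLabel 𝒜 K (.sup i x) (outEnd 𝒜 i x y) = innerLabel 𝒜 K i x.1 y := by
  have hne := finRotate_ne_self (by have := hC.three_le_length; omega : 2 ≤ C.length)
  have hne' : i ≠ (finRotate _).symm i := fun heq => hne i ((Equiv.eq_symm_apply _).1 heq)
  by_cases hy : y ≠ .u₁ ∧ y ≠ .u₂
  · rw [outEnd, dif_pos hy, superLabel, if_pos rfl]
  rcases (show y = .u₁ ∨ y = .u₂ by tauto) with rfl | rfl
  · rw [outEnd_u₁, innerLabel_comm]
    rcases (BVertex.adj_u₁_iff x).1 h.symm with rfl | rfl | rfl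
    · rw [leftEnd, if_pos rfl, superLabel, if_pos rfl]
    · rcases (𝒜 i).eq_A_or_eq_APrime with hA | hA
      · rw [leftEnd_c_of_A hA, superLabel, if_neg hne', semiLabel, if_pos (by decide)]
      · rw [leftEnd_c_of_APrime hA, superLabel, semiLabel, if_pos (by decide)]
    · rcases (𝒜 i).eq_A_or_eq_APrime with hA | hA
      · rw [leftEnd_g_of_A hA, superLabel, if_neg hne', semiLabel, if_pos (by decide)]
      · rw [leftEnd_g_of_APrime hA, superLabel, semiLabel, if_pos (by decide)]
  · rw [outEnd_u₂, innerLabel_comm]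
    rcases (BVertex.adj_u₂_iff x).1 h.symm with rfl | rfl | rfl
    · rw [rightEnd, if_pos rfl, superLabel,
        if_neg fun heq => hne i (getVert_fin_injective hC heq)]
    · rcases (𝒜 (finRotate _ i)).eq_A_or_eq_APrime with hA | hA
      · rw [rightEnd_d_of_A hA, superLabel, if_neg (hne i).symm, semiLabel, if_neg (by decide)]
      · rw [rightEnd_d_of_APrime hA, superLabel, semiLabel, if_neg (by decide)]
    · rcases (𝒜 (finRotate _ i)).eq_A_or_eq_APrime with hA | hA
      · rw [rightEnd_h_of_A hA, superLabel, if_neg (hne i).symm, semiLabel, if_neg (by decide)]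
      · rw [rightEnd_h_of_APrime hA, superLabel, semiLabel, if_neg (by decide)]

end Labels

section Coloring

variable {V : Type*} {G : SimpleGraph V} {w : V} {C : G.Walk w w} {𝒜 : Fin C.length → Supervertex}
  {K : Fin C.length → Sym2 V}

/-- The slots at either vertex of the tree correspond to the edges of `G` at that end of
`w_i w_{i+1}`. -/
theorem slotEdge_bijOn (hcard : ∀ v, (G.incidenceSet v).ncard = 3)
    (hK : ∀ i, IsThirdEdge C i (K i)) (i : Fin C.length) (b : Bool) :
    Set.BijOn (slotEdge 𝒜 K i) {t | t.IsAt b} (G.incidenceSet (slotVert C i b)) := by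
  have hnear : {t : Slot | t.IsAt true} = {.mid, .near₁, .near₂} := by
    ext t
    cases t <;> simp [Slot.IsAt]
  have hfar : {t : Slot | t.IsAt false} = {.mid, .far₁, .far₂} := by
    ext t
    cases t <;> simp [Slot.IsAt]
  have hnext := (hK (finRotate _ i)).incidenceSet_eq
  rw [Equiv.symm_apply_apply] at hnext
  by_cases h : Even (i : ℕ)
  · cases b
    · refine Set.bijOn_triple hfar ?_ (hcard _)
      simp only [slotVert, slotEdge, if_pos h, cond_false]
      exact hnext
    · refine Set.bijOn_triple hnear ?_ (hcard _)
      simp only [slotVert, slotEdge, if_pos h, cond_true]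
      rcases (𝒜 i).eq_A_or_eq_APrime with hA | hA <;>
      · rw [hA, (hK i).incidenceSet_eq]
        ext e
        simp only [Set.mem_insert_iff, Set.mem_singleton_iff]
        tauto
  · cases b
    · refine Set.bijOn_triple hfar ?_ (hcard _)
      simp only [slotVert, slotEdge, if_neg h, cond_false]
      rw [(hK i).incidenceSet_eq, Set.insert_comm]
    · refine Set.bijOn_triple hnear ?_ (hcard _)
      simp only [slotVert, slotEdge, if_neg h, cond_true]
      exact hnext

theorem bijOn_superLabel_sup (hC : C.IsCycle) (hcard : ∀ v, (G.incidenceSet v).ncard = 3)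
    (hK : ∀ i, IsThirdEdge C i (K i)) (i : Fin C.length) (x : BVertex) :
    Set.BijOn (superLabel 𝒜 K (.sup i x)) ((superposition C 𝒜).neighborSet (.sup i x))
      (G.incidenceSet (superVert 𝒜 (.sup i x))) :=
  ((slotEdge_bijOn hcard hK i _).comp ((placement 𝒜 i).slot_bijOn x.1 x.2)).of_lift
    (outEnd 𝒜 i x) (fun _ hy => adj_outEnd hy) (fun _ hy => superLabel_outEnd hC hy)
    (fun _ hu => exists_outEnd_eq hu)

theorem bijOn_superLabel_upper (hn : Even C.length)
    (hcard : ∀ v, (G.incidenceSet v).ncard = 3)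
    (hK : ∀ i, IsThirdEdge C i (K i))
    (j : Fin C.length) (hj : 𝒜 j = .APrime) :
    Set.BijOn (superLabel 𝒜 K (.upper j hj)) ((superposition C 𝒜).neighborSet (.upper j hj))
      (G.incidenceSet (C.getVert j)) := by
  refine Set.bijOn_triple (neighborSet_upper hj) ?_ (hcard _)
  simp only [superLabel, rungLabel]
  rw [(hK j).incidenceSet_eq]
  by_cases h : Even (j : ℕ)
  · have h' := mt (even_finRotate_symm hn j).1 (not_not.2 h)
    rw [if_pos h, semiLabel_d_of_not_even h', semiLabel_c_of_even h,
      slotEdge_near₂_of_APrime h hj, Equiv.apply_symm_apply]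
    ext e
    simp only [Set.mem_insert_iff, Set.mem_singleton_iff]
    tauto
  · have h' := (even_finRotate_symm hn j).2 h
    rw [if_neg h, semiLabel_d_of_even h', semiLabel_c_of_APrime h hj]

theorem bijOn_superLabel_lower (hn : Even C.length)
    (hcard : ∀ v, (G.incidenceSet v).ncard = 3)
    (hK : ∀ i, IsThirdEdge C i (K i))
    (j : Fin C.length) (hj : 𝒜 j = .APrime) :
    Set.BijOn (superLabel 𝒜 K (.lower j hj)) ((superposition C 𝒜).neighborSet (.lower j hj))
      (G.incidenceSet (C.getVert j)) := by
  refine Set.bijOn_triple (neighborSet_lower hj) ?_ (hcard _)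
  simp only [superLabel, rungLabel]
  rw [(hK j).incidenceSet_eq]
  by_cases h : Even (j : ℕ)
  · have h' := mt (even_finRotate_symm hn j).1 (not_not.2 h)
    rw [if_pos h, semiLabel_h_of_not_even h', semiLabel_g_of_even h,
      slotEdge_near₂_of_APrime h hj, Equiv.apply_symm_apply]
    ext e
    simp only [Set.mem_insert_iff, Set.mem_singleton_iff]
    tauto
  · have h' := (even_finRotate_symm hn j).2 h
    rw [if_neg h, semiLabel_h_of_even h', semiLabel_g_of_APrime h hj, Equiv.apply_symm_apply,
      Set.insert_comm]

/-- At `w_j` the two edges of the superposition that replace the edges of `C` are sent to those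
two edges, in this order for even `j` and exchanged for odd `j`. -/
theorem bijOn_superLabel_getVert (hC : C.IsCycle) (hn : Even C.length)
    (hcard : ∀ v, (G.incidenceSet v).ncard = 3)
    (hK : ∀ i, IsThirdEdge C i (K i)) (j : Fin C.length) :
    Set.BijOn (superLabel 𝒜 K (.base (C.getVert j)))
      ((superposition C 𝒜).neighborSet (.base (C.getVert j)))
      (G.incidenceSet (C.getVert j)) := by
  have hmem : ∀ i, walkEdge C i ∈ C.edges := fun i => (mem_edges_iff_walkEdge C _).2 ⟨i, rfl⟩
  have hinj := getVert_fin_injective hC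
  have hKj : K j ∈ G.incidenceSet (C.getVert j) := by
    rw [(hK j).incidenceSet_eq]
    exact Or.inr (Or.inr rfl)
  obtain ⟨z, hz⟩ := Sym2.mem_iff_exists.1 hKj.2
  have hnbrs : (superposition C 𝒜).neighborSet (.base (C.getVert j)) =
      {.base z, .sup ((finRotate _).symm j) BVertex.a, .sup j BVertex.a} := by
    ext u
    rw [SimpleGraph.mem_neighborSet, adj_base_iff]
    constructor
    · rintro (⟨v', rfl, hG, hv'⟩ | ⟨i, hi, rfl⟩ | ⟨i, hi, rfl⟩)
      · have h : s(C.getVert j, v') ∈ G.incidenceSet (C.getVert j) := ⟨hG, Sym2.mem_mk_left _ _⟩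
        rw [(hK j).incidenceSet_eq] at h
        rcases h with h | h | h
        · exact absurd (h ▸ hmem _) hv'
        · exact absurd (h ▸ hmem _) hv'
        · rw [Set.mem_singleton_iff, hz, Sym2.congr_right] at h
          exact Or.inl (by rw [h])
      · obtain rfl := hinj hi
        exact Or.inr (Or.inr rfl)
      · obtain rfl := (Equiv.symm_apply_eq _).2 (hinj hi)
        exact Or.inr (Or.inl rfl)
    · rintro (rfl | rfl | rfl)
      · exact Or.inl ⟨z, rfl, (hz ▸ hKj).1, hz ▸ (hK j).not_mem⟩
      · exact Or.inr (Or.inr ⟨_, by rw [Equiv.apply_symm_apply], rfl⟩)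
      · exact Or.inr (Or.inl ⟨j, rfl, rfl⟩)
  refine Set.bijOn_triple hnbrs ?_ (hcard _)
  have hne : C.getVert j ≠ C.getVert ((finRotate _).symm j) := fun h =>
    finRotate_ne_self (by have := hC.three_le_length; omega : 2 ≤ C.length) j
      ((Equiv.eq_symm_apply _).1 (hinj h))
  rw [superLabel, superLabel, superLabel, if_neg hne, if_pos rfl, ← hz, (hK j).incidenceSet_eq]
  change _ = ({K j, innerLabel 𝒜 K _ .u₂ .a, innerLabel 𝒜 K j .u₁ .a} : Set (Sym2 V))
  by_cases h : Even (j : ℕ)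
  · have h' := mt (even_finRotate_symm hn j).1 (not_not.2 h)
    rw [innerLabel_u₂_a_of_not_even h', innerLabel_u₁_a_of_even h]
    ext e
    simp only [Set.mem_insert_iff, Set.mem_singleton_iff]
    tauto
  · have h' := (even_finRotate_symm hn j).2 h
    rw [innerLabel_u₂_a_of_even h', innerLabel_u₁_a_of_not_even h, Equiv.apply_symm_apply]
    ext e
    simp only [Set.mem_insert_iff, Set.mem_singleton_iff]
    tauto

theorem bijOn_superLabel_base_of_forall_ne {v : V} (hv : ∀ i : Fin C.length, v ≠ C.getVert i) :
    Set.BijOn (superLabel 𝒜 K (.base v)) ((superposition C 𝒜).neighborSet (.base v))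
      (G.incidenceSet v) := by
  have hstar : Set.BijOn (fun v' => s(v, v')) (G.neighborSet v) (G.incidenceSet v) := by
    refine ⟨fun v' h => ⟨h, Sym2.mem_mk_left _ _⟩, fun x _ y _ h => Sym2.congr_right.1 h, ?_⟩
    rintro e ⟨he, hve⟩
    obtain ⟨v', rfl⟩ := Sym2.mem_iff_exists.1 hve
    exact ⟨v', he, rfl⟩
  refine hstar.of_lift .base (fun v' h => adj_base_iff.2 (Or.inl ⟨v', rfl, h, fun hC => ?_⟩))
    (fun v' _ => rfl) fun u hu => ?_
  · obtain ⟨i, hi⟩ := (mem_edges_iff_walkEdge C _).1 hC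
    rcases Sym2.mem_iff.1 (hi ▸ Sym2.mem_mk_left v v' : v ∈ walkEdge C i) with h | h
    exacts [hv _ h, hv _ h]
  · rcases adj_base_iff.1 hu with ⟨v', rfl, hG, -⟩ | ⟨i, hi, -⟩ | ⟨i, hi, -⟩
    exacts [⟨v', hG, rfl⟩, absurd hi (hv _), absurd hi (hv _)]

variable (𝒜) in
/-- The coloring of the superposition by `G`. -/
noncomputable def superColoring (hC : C.IsCycle) (hn : Even C.length)
    (hcard : ∀ v, (G.incidenceSet v).ncard = 3)
    (hK : ∀ i, IsThirdEdge C i (K i)) :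
    GraphColoring (superposition C 𝒜) G where
  vert := superVert 𝒜
  label := superLabel 𝒜 K
  label_comm _ _ h := superLabel_comm hC hn h
  bijOn
    | .base v => by
      by_cases hv : ∃ i : Fin C.length, v = C.getVert i
      · obtain ⟨i, rfl⟩ := hv
        exact bijOn_superLabel_getVert hC hn hcard hK i
      · exact bijOn_superLabel_base_of_forall_ne (not_exists.1 hv)
    | .sup i x => bijOn_superLabel_sup hC hcard hK i x
    | .upper j hj => bijOn_superLabel_upper hn hcard hK j hj
    | .lower j hj => bijOn_superLabel_lower hn hcard hK j hj

/-! ### Counting the poor edges -/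

/-- The six edges of the superedge `B` that do not join a near vertex to a far one. -/
def sameSideEdge : Fin 6 → PetersenVertex × PetersenVertex :=
  ![(.c, .d), (.d, .e), (.e, .g), (.a, .b), (.b, .f), (.f, .h)]

theorem sameSideEdge_injective (m m' : Fin 6)
    (h : s((sameSideEdge m).1, (sameSideEdge m).2) =
      s((sameSideEdge m').1, (sameSideEdge m').2)) : m = m' := by
  revert m m'
  decide

theorem Placement.act_mem (t : Placement) :
    ∀ m, (t.act (sameSideEdge m).1 ≠ .u₁ ∧ t.act (sameSideEdge m).1 ≠ .u₂) ∧
      t.act (sameSideEdge m).2 ≠ .u₁ ∧ t.act (sameSideEdge m).2 ≠ .u₂ := by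
  revert t
  decide

variable (𝒜) in
/-- The `m`-th edge of `B_i` whose two ends have the same image in `G`. -/
def monoEdge (p : Fin C.length × Fin 6) : (superposition C 𝒜).edgeSet :=
  ⟨s(.sup p.1 ⟨_, ((placement 𝒜 p.1).act_mem p.2).1⟩,
     .sup p.1 ⟨_, ((placement 𝒜 p.1).act_mem p.2).2⟩), by
    have hadj : ∀ m, petersen.Adj (sameSideEdge m).1 (sameSideEdge m).2 := by decide
    have h := ((placement 𝒜 p.1).adj_act _ _).2 (hadj p.2)
    refine superLink_adj (fun heq => h.ne ?_) (.inner _ _ _ h)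
    exact congrArg Subtype.val (SuperVertexSet.sup.inj heq).2⟩

theorem monoEdge_injective : Function.Injective (monoEdge 𝒜) := by
  rintro ⟨i, m⟩ ⟨i', m'⟩ h
  have hedge := Sym2.eq_iff.1 (congrArg Subtype.val h)
  simp only [SuperVertexSet.sup.injEq, Subtype.mk.injEq] at hedge
  obtain rfl : i = i' := by tauto
  have hinj := (placement 𝒜 i).act_injective
  obtain rfl : m = m' := by
    refine sameSideEdge_injective m m' (Sym2.eq_iff.2 ?_)
    exact hedge.imp (fun h => ⟨hinj h.1.2, hinj h.2.2⟩) (fun h => ⟨hinj h.1.2, hinj h.2.2⟩)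
  rfl

theorem isPoor_monoEdge [G.LocallyFinite] (hG : G.IsRegularOfDegree 3)
    (Φ : GraphColoring (superposition C 𝒜) G) (hΦ : Φ.vert = superVert 𝒜) {k : ℕ}
    (σ : EdgeColoring G k) (p : Fin C.length × Fin 6) :
    IsPoor (Φ.pullback σ) (monoEdge 𝒜 p) := by
  refine Φ.isPoor_of_vert_eq hG σ _ ?_
  have hside : ∀ m, isNear (sameSideEdge m).1 = isNear (sameSideEdge m).2 := by decide
  rw [hΦ, superVert, superVert, Placement.act_act, Placement.act_act, hside]

end Coloring

theorem theorem2 {V : Type*} [Fintype V] (G : SimpleGraph V) [DecidableRel G.Adj]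
    (hG : IsSnark G) (σ : EdgeColoring G 5) (hσ : IsNormalColoring σ)
    (w : V) (C : G.Walk w w) (hC : C.IsCycle) (hCeven : Even C.length)
    (𝒜 : Fin C.length → Supervertex) :
    ∃ τ : EdgeColoring (superposition C 𝒜) 5,
      IsNormalColoring τ ∧
      (∀ (e : G.edgeSet) (he : (e : Sym2 V) ∉ C.edges), τ (keptEdge C 𝒜 e he) = σ e) ∧
      18 ≤ {e : (superposition C 𝒜).edgeSet | IsPoor τ e}.ncard := by
  have hcard := ncard_incidenceSet hG.cubic
  choose K hK using exists_isThirdEdge hG.cubic hC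
  let Φ := superColoring 𝒜 hC hCeven hcard hK
  refine ⟨Φ.pullback σ, Φ.isNormalColoring_pullback hG.cubic hσ, ?_, ?_⟩
  · rintro ⟨e, he⟩ heC
    induction e using Sym2.ind with
    | _ v v' => exact congrArg σ (Subtype.ext (Φ.edge_mk (u := .base v) (v := .base v') _))
  · have hlength : 4 ≤ C.length := by
      have h3 := hC.three_le_length
      obtain ⟨m, hm⟩ := hCeven
      omega
    have hrange : (Set.range (monoEdge 𝒜)).ncard = C.length * 6 := by
      rw [← Set.image_univ, Set.ncard_image_of_injective _ monoEdge_injective, Set.ncard_univ,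
        Nat.card_prod, Nat.card_eq_fintype_card, Nat.card_eq_fintype_card, Fintype.card_fin,
        Fintype.card_fin]
    have hsub : Set.range (monoEdge 𝒜) ⊆
        {e : (superposition C 𝒜).edgeSet | IsPoor (Φ.pullback σ) e} := by
      rintro _ ⟨p, rfl⟩
      exact isPoor_monoEdge hG.cubic Φ rfl σ p
    have hle := Set.ncard_le_ncard hsub (Set.toFinite _)
    omega
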